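/- Let $A\in\mathbb R^{n\times n}$ be asymptotically stable (all eigenvalues have negative real part), and let $B\in\mathbb R^{n\times m}$, $C\in\mathbb R^{p\times n}$, $X_0\in\mathbb R^{n\times q}$, $\beta>0$. For $\alpha>0$ let $\eta_1(\alpha)\ge\dots\ge\eta_n(\alpha)\ge 0$ be the Hankel singular values of the system $$\Big[A,\ B_\alpha,\ C\Big],\qquad B_\alpha=\begin{bmatrix}B & \frac{1}{\beta\sqrt{2\alpha}}(A+\alpha I_n)X_0\end{bmatrix},$$ that is, the square roots of the eigenvalues, counted with multiplicity, of $\mathcal P(\alpha)Q$, where $\mathcal P(\alpha)$ and $Q$ are the solutions of $A\mathcal P+\mathcal PA^{\mathsf T}+B_\alpha B_\alpha^{\mathsf T}=0$ and $A^{\mathsf T}Q+QA+C^{\mathsf T}C=0$. Let $R,\hat R,L$ be real matrices with $n$ rows such that $Q=LL^{\mathsf T}$ and such that $P=RR^{\mathsf T}$ and $\hat P=\hat R\hat R^{\mathsf T}$ solve $AP+PA^{\mathsf T}+BB^{\mathsf T}=0$ and $A\hat P+\hat PA^{\mathsf T}+X_0X_0^{\mathsf T}=0$, and put $$M(\alpha)=\begin{bmatrix}L^{\mathsf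 T}R & \frac{1}{\beta\sqrt{2\alpha}}L^{\mathsf T}A\hat R+\frac{\sqrt{\alpha}}{\sqrt2\,\beta}L^{\mathsf T}\hat R\end{bmatrix}.$$ Let $1\le r\le n-1$ and $c_u(\alpha)=2\sum_{i=r+1}^n\eta_i(\alpha)$. Let $\alpha_0>0$ be such that $\eta_{r+1}(\cdot)$ is not differentiable at $\alpha_0$, $$\eta_{r-1}(\alpha_0)>\eta_r(\alpha_0)=\eta_{r+1}(\alpha_0)>\eta_{r+2}(\alpha_0)$$ (where the first inequality is omitted if $r=1$ and the last one if $r=n-1$), and $M(\cdot)$ has constant rank in a neighborhood of $\alpha_0$. Then $c_u$ has a left and a right derivative at $\alpha_0$, the right derivative is strictly smaller than the left derivative, and $\alpha_0$ is not a local minimizer of $c_u$. -/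

import Mathlib

open Filter Topology Set

noncomputable section

/-- `A` is asymptotically stable: all its complex eigenvalues have negative real part. -/
def AsymptoticallyStable {n : ℕ} (A : Matrix (Fin n) (Fin n) ℝ) : Prop :=
  ∀ z ∈ spectrum ℂ (A.map ((↑) : ℝ → ℂ)), z.re < 0

/-- `P` solves the controllability Lyapunov equation `A P + P Aᵀ + B Bᵀ = 0`. -/
def IsControllabilityGramian {n : ℕ} {ι : Type} [Fintype ι]
    (A : Matrix (Fin n) (Fin n) ℝ) (B : Matrix (Fin n) ι ℝ)
    (P : Matrix (Fin n) (Fin n) ℝ) : Prop :=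
  A * P + P * A.transpose + B * B.transpose = 0

/-- `Q` solves the observability Lyapunov equation `Aᵀ Q + Q A + Cᵀ C = 0`. -/
def IsObservabilityGramian {n : ℕ} {κ : Type} [Fintype κ]
    (A : Matrix (Fin n) (Fin n) ℝ) (C : Matrix κ (Fin n) ℝ)
    (Q : Matrix (Fin n) (Fin n) ℝ) : Prop :=
  A.transpose * Q + Q * A + C.transpose * C = 0

/-- The controllability Gramian of the system `[A, B, C]`: the solution of the controllability
Lyapunov equation, which exists and is unique when `A` is asymptotically stable. -/
def controllabilityGramian {n : ℕ} {ι : Type} [Fintype ι]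
    (A : Matrix (Fin n) (Fin n) ℝ) (B : Matrix (Fin n) ι ℝ) : Matrix (Fin n) (Fin n) ℝ :=
  Classical.epsilon (IsControllabilityGramian A B)

/-- The observability Gramian of the system `[A, B, C]`: the solution of the observability
Lyapunov equation, which exists and is unique when `A` is asymptotically stable. -/
def observabilityGramian {n : ℕ} {κ : Type} [Fintype κ]
    (A : Matrix (Fin n) (Fin n) ℝ) (C : Matrix κ (Fin n) ℝ) : Matrix (Fin n) (Fin n) ℝ :=
  Classical.epsilon (IsObservabilityGramian A C)

/-- The `i`-th Hankel singular value (`1 ≤ i ≤ n`) of the system `[A, B, C]`: the square root of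
the `i`-th largest eigenvalue, counted with multiplicity, of the product of the controllability
and the observability Gramian. For asymptotically stable `A` this product of two positive
semidefinite matrices has `n` real nonnegative eigenvalues. -/
def hankelSingularValue {n : ℕ} {ι κ : Type} [Fintype ι] [Fintype κ]
    (A : Matrix (Fin n) (Fin n) ℝ) (B : Matrix (Fin n) ι ℝ) (C : Matrix κ (Fin n) ℝ)
    (i : ℕ) : ℝ :=
  Real.sqrt (((controllabilityGramian A B * observabilityGramian A C).charpoly.roots.sort
    (· ≥ ·)).getD (i - 1) 0)

/-- The expanded input matrix `[B, (1 / (β √(2α))) (A + α I) X₀]`. -/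
def expandedInput {n m q : ℕ} (A : Matrix (Fin n) (Fin n) ℝ) (B : Matrix (Fin n) (Fin m) ℝ)
    (X₀ : Matrix (Fin n) (Fin q) ℝ) (β α : ℝ) : Matrix (Fin n) (Fin m ⊕ Fin q) ℝ :=
  Matrix.fromCols B ((1 / (β * Real.sqrt (2 * α))) • ((A + α • (1 : Matrix (Fin n) (Fin n) ℝ)) * X₀))

/-- `η_i(α)`: the `i`-th Hankel singular value, in decreasing order and starting from `i = 1`,
of the system with the expanded input matrix. -/
def shiftHSV {n m p q : ℕ} (A : Matrix (Fin n) (Fin n) ℝ) (B : Matrix (Fin n) (Fin m) ℝ)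
    (C : Matrix (Fin p) (Fin n) ℝ) (X₀ : Matrix (Fin n) (Fin q) ℝ) (β : ℝ) (i : ℕ) (α : ℝ) : ℝ :=
  hankelSingularValue A (expandedInput A B X₀ β α) C i

/-- `c_u(α) = 2 (η_{r+1}(α) + ⋯ + η_n(α))`. -/
def errorConstant {n m p q : ℕ} (A : Matrix (Fin n) (Fin n) ℝ) (B : Matrix (Fin n) (Fin m) ℝ)
    (C : Matrix (Fin p) (Fin n) ℝ) (X₀ : Matrix (Fin n) (Fin q) ℝ) (β : ℝ) (r : ℕ) (α : ℝ) : ℝ :=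
  2 * ∑ i ∈ Finset.Icc (r + 1) n, shiftHSV A B C X₀ β i α

/-- `M(α) = [Lᵀ R, (1 / (β √(2α))) Lᵀ A Rh + (√α / (√2 β)) Lᵀ Rh]`. -/
def factorMatrix {n k kh l : ℕ} (A : Matrix (Fin n) (Fin n) ℝ) (R : Matrix (Fin n) (Fin k) ℝ)
    (Rh : Matrix (Fin n) (Fin kh) ℝ) (L : Matrix (Fin n) (Fin l) ℝ) (β α : ℝ) :
    Matrix (Fin l) (Fin k ⊕ Fin kh) ℝ :=
  Matrix.fromCols (L.transpose * R)
    ((1 / (β * Real.sqrt (2 * α))) • (L.transpose * A * Rh)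
      + (Real.sqrt α / (Real.sqrt 2 * β)) • (L.transpose * Rh))

end

/-! With `M` the factor matrix, the Gramian product has the same positive eigenvalues as `M * Mᵀ`,
so the nonzero Hankel singular values are the positive eigenvalues of the dilation `H = [[0, M],
[Mᵀ, 0]]`. This avoids square roots of eigenvalues: `H` is symmetric and differentiable in `α`.

Let `σ_k` be the sum of the `k` largest eigenvalues of `H`, and `ρ` the constant rank of `M`. Near
`α₀`, `c_u = 2 (σ_ρ - σ_r)` and `η_{r+1} = σ_{r+1} - σ_r`. By Ky Fan, `σ_k` is a maximum of linear
functionals of `H`. Hence along the curve it has one-sided derivatives, left at most right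
(`exists_oneSided_deriv_topEigSum`), and it is differentiable where the `k`-th and next eigenvalues
differ (`differentiableAt_topEigSum`). There is such a gap at `ρ`, between positive and nonpositive
eigenvalues, and at `r + 1`. So the kink of `η_{r+1}` comes from `σ_r`, whose one-sided derivatives
must differ; it enters `c_u` with a minus sign, giving a concave kink, which no local minimizer can
have. -/

/-- The `i`-th largest element (starting from `i = 0`) of a multiset of reals, and `0` beyond the
cardinality. -/
noncomputable def nthLargest (s : Multiset ℝ) (i : ℕ) : ℝ := (s.sort (· ≥ ·)).getD i 0

/-! ### Ordered elements of a multiset and its positive part -/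

namespace nthLargest

theorem sort_eq_append (s : Multiset ℝ) :
    s.sort (· ≥ ·) =
      (s.filter (0 < ·)).sort (· ≥ ·) ++ (s.filter (¬ 0 < ·)).sort (· ≥ ·) := by
  refine List.Perm.eq_of_pairwise' (s.pairwise_sort (· ≥ ·)) ?_ ?_
  · rw [List.pairwise_append]
    refine ⟨Multiset.pairwise_sort _ _, Multiset.pairwise_sort _ _, fun a ha b hb => ?_⟩
    simp only [Multiset.mem_sort, Multiset.mem_filter] at ha hb
    linarith [ha.2, hb.2]
  · rw [← Multiset.coe_eq_coe, ← Multiset.coe_add]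
    simp only [Multiset.sort_eq]
    exact (Multiset.filter_add_not _ s).symm

theorem mem_of_lt {s : Multiset ℝ} {i : ℕ} (h : i < s.card) : nthLargest s i ∈ s := by
  have h' : i < (s.sort (· ≥ ·)).length := by simpa using h
  rw [nthLargest, List.getD_eq_getElem _ _ h']
  exact (Multiset.mem_sort _).1 (List.getElem_mem h')

theorem of_card_le {s : Multiset ℝ} {i : ℕ} (h : s.card ≤ i) : nthLargest s i = 0 :=
  List.getD_eq_default _ _ (by simpa using h)

/-- Positive elements come first in the decreasing order, so spectra that differ only in zero or
negative eigenvalues can be compared index by index. -/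
theorem filter_pos {s : Multiset ℝ} {i : ℕ} (h : i < (s.filter (0 < ·)).card) :
    nthLargest (s.filter (0 < ·)) i = nthLargest s i := by
  rw [nthLargest, nthLargest, sort_eq_append s, List.getD_append _ _ _ _ (by simpa using h)]

theorem pos {s : Multiset ℝ} {i : ℕ} (h : i < (s.filter (0 < ·)).card) :
    0 < nthLargest s i := by
  rw [← filter_pos h]
  exact (Multiset.mem_filter.1 (mem_of_lt h)).2

theorem nonpos {s : Multiset ℝ} {i : ℕ} (h : (s.filter (0 < ·)).card ≤ i) :
    nthLargest s i ≤ 0 := by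
  rw [nthLargest, sort_eq_append s, List.getD_append_right _ _ _ _ (by simpa using h)]
  change nthLargest (s.filter (¬ 0 < ·)) _ ≤ 0
  rcases lt_or_ge (i - ((s.filter (0 < ·)).sort (· ≥ ·)).length) (s.filter (¬ 0 < ·)).card
    with h' | h'
  · exact not_lt.1 (Multiset.mem_filter.1 (mem_of_lt h')).2
  · exact (of_card_le h').le

theorem map_sqrt {s : Multiset ℝ} (hs : ∀ a ∈ s, 0 < a) (i : ℕ) :
    nthLargest (s.map Real.sqrt) i = Real.sqrt (nthLargest s i) := by
  have h := Multiset.map_sort Real.sqrt s (· ≥ ·) (· ≥ ·)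
    (fun a ha b hb => (Real.sqrt_le_sqrt_iff (hs a ha).le).symm)
  rw [nthLargest, nthLargest, ← h]
  conv_lhs => rw [← Real.sqrt_zero]
  exact List.getD_map _ _ _

end nthLargest

/-! ### Spectrum of the symmetric dilation -/

section Dilation

open Matrix Polynomial

variable {ι κ : Type*}

/-- The symmetric dilation `[[0, M], [Mᵀ, 0]]` of a matrix `M`. -/
def Matrix.dilation (M : Matrix ι κ ℝ) : Matrix (ι ⊕ κ) (ι ⊕ κ) ℝ := fromBlocks 0 M Mᵀ 0

theorem Matrix.dilation_transpose (M : Matrix ι κ ℝ) : M.dilationᵀ = M.dilation := by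
  simp [Matrix.dilation, fromBlocks_transpose]

variable [Fintype ι] [Fintype κ] [DecidableEq ι]

theorem Matrix.roots_charpoly_mul_transpose_nonneg (M : Matrix ι κ ℝ) :
    ∀ a ∈ (M * Mᵀ).charpoly.roots, 0 ≤ a := by
  have hp : (M * Mᵀ).PosSemidef := by simpa using posSemidef_self_mul_conjTranspose M
  intro a ha
  rw [hp.1.roots_charpoly_eq_eigenvalues] at ha
  obtain ⟨i, -, rfl⟩ := Multiset.mem_map.1 ha
  exact hp.eigenvalues_nonneg i

/-- The multiset of positive eigenvalues of `M * Mᵀ`. -/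
noncomputable def Matrix.posSqSingularValues (M : Matrix ι κ ℝ) : Multiset ℝ :=
  (M * Mᵀ).charpoly.roots.filter (0 < ·)

theorem Matrix.card_posSqSingularValues (M : Matrix ι κ ℝ) :
    M.posSqSingularValues.card = M.rank := by
  have hp : (M * Mᵀ).PosSemidef := by simpa using posSemidef_self_mul_conjTranspose M
  rw [← rank_self_mul_transpose M, hp.1.rank_eq_card_non_zero_eigs, Matrix.posSqSingularValues,
    hp.1.roots_charpoly_eq_eigenvalues, Multiset.filter_map, Multiset.card_map,
    Fintype.card_subtype]
  rw [Finset.card, Finset.filter_val]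
  congr 1
  refine Multiset.filter_congr fun i _ => ?_
  exact (hp.eigenvalues_nonneg i).lt_iff_ne'

variable [DecidableEq κ]

/-- Multiplying the characteristic matrix on the right by `[[X, 0], [Mᵀ, 1]]` makes it block
triangular with diagonal blocks `X² - M Mᵀ` and `X`; take determinants. Powers of `X` on both sides
avoid comparing the two dimensions. -/
theorem Matrix.X_pow_mul_charpoly_dilation (M : Matrix ι κ ℝ) :
    (X : ℝ[X]) ^ Fintype.card ι * M.dilation.charpoly =
      X ^ Fintype.card κ * (M * Mᵀ).charpoly.comp (X ^ 2) := by
  have hdil : M.dilation.charmatrix =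
      fromBlocks (scalar ι X) (-M.map C) (-Mᵀ.map C) (scalar κ X) := by
    rw [Matrix.dilation, charmatrix_fromBlocks]
    simp [charmatrix]
  have hprod : M.dilation.charmatrix * fromBlocks (scalar ι X) 0 (Mᵀ.map C) 1 =
      fromBlocks (scalar ι (X ^ 2) - (M * Mᵀ).map C) (-M.map C) 0 (scalar κ X) := by
    rw [hdil, fromBlocks_multiply]
    congr 1
    · rw [Matrix.map_mul, ← map_mul, pow_two, Matrix.neg_mul, sub_eq_add_neg]
    · simp
    · rw [← scalar_comm (X : ℝ[X]) (fun r => mul_comm _ _)]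
      simp
    · simp
  have hcomp : (scalar ι (X ^ 2 : ℝ[X]) - (M * Mᵀ).map C).det =
      (M * Mᵀ).charpoly.comp (X ^ 2) := by
    rw [Matrix.charpoly, ← coe_compRingHom_apply, RingHom.map_det]
    congr 1
    ext i j
    rcases eq_or_ne i j with rfl | hij
    · simp [-Matrix.map_mul]
    · simp [hij, -Matrix.map_mul]
  have hdet := congrArg Matrix.det hprod
  rw [det_mul, det_fromBlocks_zero₁₂, det_fromBlocks_zero₂₁, hcomp] at hdet
  simp only [det_one, mul_one, scalar_apply, det_diagonal, Finset.prod_const,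
    Finset.card_univ] at hdet
  rw [mul_comm, mul_comm (X ^ Fintype.card κ)]
  exact hdet

theorem Polynomial.roots_comp_X_sq {s : Multiset ℝ} (hs : ∀ a ∈ s, 0 ≤ a) :
    ((s.map fun a => X - C a).prod.comp (X ^ 2)).roots =
      s.map Real.sqrt + s.map fun a => -Real.sqrt a := by
  have h : (s.map fun a => X - C a).prod.comp (X ^ 2) =
      ((s.map Real.sqrt + s.map fun a => -Real.sqrt a).map fun a => X - C a).prod := by
    rw [multiset_prod_comp, Multiset.map_add, Multiset.prod_add]
    simp only [Multiset.map_map, Function.comp_def]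
    rw [← Multiset.prod_map_mul]
    refine congrArg _ (Multiset.map_congr rfl fun a ha => ?_)
    have : (C a : ℝ[X]) = C (Real.sqrt a) * C (Real.sqrt a) := by
      rw [← C_mul, Real.mul_self_sqrt (hs a ha)]
    rw [sub_comp, X_comp, C_comp, this, map_neg]
    ring
  rw [h, roots_multiset_prod_X_sub_C]

theorem Matrix.roots_charpoly_dilation (M : Matrix ι κ ℝ) :
    Fintype.card ι • {0} + M.dilation.charpoly.roots = Fintype.card κ • {0} +
      ((M * Mᵀ).charpoly.roots.map Real.sqrt +
        (M * Mᵀ).charpoly.roots.map fun a => -Real.sqrt a) := by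
  have h := congrArg Polynomial.roots M.X_pow_mul_charpoly_dilation
  have hne : (M * Mᵀ).charpoly.comp (X ^ 2) ≠ 0 := by
    intro h0
    have := M.X_pow_mul_charpoly_dilation
    rw [h0, mul_zero] at this
    exact mul_ne_zero (pow_ne_zero _ X_ne_zero) M.dilation.charpoly_monic.ne_zero this
  rw [roots_mul (mul_ne_zero (pow_ne_zero _ X_ne_zero) M.dilation.charpoly_monic.ne_zero),
    roots_mul (mul_ne_zero (pow_ne_zero _ X_ne_zero) hne), roots_X_pow, roots_X_pow] at h
  rw [h, ← roots_comp_X_sq M.roots_charpoly_mul_transpose_nonneg]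
  congr 3
  exact (by simpa using isHermitian_mul_conjTranspose_self M :
    (M * Mᵀ).IsHermitian).splits_charpoly.eq_prod_roots_of_monic
    (charpoly_monic _)

theorem Matrix.filter_pos_roots_charpoly_dilation (M : Matrix ι κ ℝ) :
    M.dilation.charpoly.roots.filter (0 < ·) = M.posSqSingularValues.map Real.sqrt := by
  have h := congrArg (Multiset.filter (0 < ·)) M.roots_charpoly_dilation
  simpa [Multiset.filter_nsmul, Multiset.filter_singleton, Multiset.filter_map,
    Function.comp_def, Matrix.posSqSingularValues, (Real.sqrt_nonneg _).not_gt] using h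

/-- The two characteristic polynomials agree up to powers of `X`, which contribute only zero roots.
-/
theorem Matrix.filter_pos_roots_charpoly_mul_comm (A : Matrix ι κ ℝ) (B : Matrix κ ι ℝ) :
    (A * B).charpoly.roots.filter (0 < ·) = (B * A).charpoly.roots.filter (0 < ·) := by
  have h := congrArg (fun p => p.roots.filter (0 < ·)) (charpoly_mul_comm' A B)
  rw [roots_mul (mul_ne_zero (pow_ne_zero _ X_ne_zero) (charpoly_monic _).ne_zero),
    roots_mul (mul_ne_zero (pow_ne_zero _ X_ne_zero) (charpoly_monic _).ne_zero),
    roots_X_pow, roots_X_pow] at h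
  simpa [Multiset.filter_nsmul, Multiset.filter_singleton] using h

end Dilation

/-! ### Ky Fan's maximum principle -/

section KyFan

open Matrix

variable {ι : Type*} [Fintype ι]

/-- `S` is an orthogonal projection of rank `k`. -/
structure IsRankProj (k : ℕ) (S : Matrix ι ι ℝ) : Prop where
  transpose : Sᵀ = S
  idem : S * S = S
  trace : S.trace = k

theorem Matrix.sum_sq_eq_trace (X : Matrix ι ι ℝ) :
    ∑ i, ∑ j, X i j ^ 2 = (X * Xᵀ).trace := by
  simp [Matrix.trace, Matrix.mul_apply, pow_two]

namespace IsRankProj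

variable {k : ℕ} {S : Matrix ι ι ℝ}

theorem sum_sq (h : IsRankProj k S) : ∑ i, ∑ j, S i j ^ 2 = k := by
  rw [Matrix.sum_sq_eq_trace, h.transpose, h.idem, h.trace]

theorem diag_eq (h : IsRankProj k S) (i : ι) : S i i = ∑ j, S i j ^ 2 := by
  conv_lhs => rw [← h.idem]
  rw [Matrix.mul_apply]
  refine Finset.sum_congr rfl fun j _ => ?_
  rw [pow_two]
  congr 1
  exact congrFun (congrFun h.transpose i) j

theorem diag_nonneg (h : IsRankProj k S) (i : ι) : 0 ≤ S i i := by
  rw [h.diag_eq]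
  positivity

theorem diag_le_one (h : IsRankProj k S) (i : ι) : S i i ≤ 1 := by
  have h1 : S i i ^ 2 ≤ S i i := by
    conv_rhs => rw [h.diag_eq]
    exact Finset.single_le_sum (f := fun j => S i j ^ 2) (fun j _ => sq_nonneg _)
      (Finset.mem_univ i)
  nlinarith

theorem abs_apply_le (h : IsRankProj k S) (i j : ι) : |S i j| ≤ k + 1 := by
  have h1 : S i j ^ 2 ≤ k := by
    rw [← h.sum_sq]
    refine le_trans ?_ (Finset.single_le_sum (f := fun i => ∑ j, S i j ^ 2)
      (fun i _ => by positivity) (Finset.mem_univ i))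
    exact Finset.single_le_sum (f := fun j => S i j ^ 2) (fun j _ => sq_nonneg _)
      (Finset.mem_univ j)
  refine abs_le_of_sq_le_sq ?_ (by positivity)
  nlinarith [(Nat.cast_nonneg k : (0 : ℝ) ≤ k)]

theorem conj [DecidableEq ι] (h : IsRankProj k S) {U : Matrix ι ι ℝ} (hU : U * Uᵀ = 1) :
    IsRankProj k (Uᵀ * S * U) where
  transpose := by simp [Matrix.transpose_mul, h.transpose, Matrix.mul_assoc]
  idem := by
    calc Uᵀ * S * U * (Uᵀ * S * U) = Uᵀ * S * (U * Uᵀ) * S * U := by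
          simp only [Matrix.mul_assoc]
      _ = Uᵀ * (S * S) * U := by rw [hU, Matrix.mul_one, Matrix.mul_assoc Uᵀ]
      _ = Uᵀ * S * U := by rw [h.idem]
  trace := by
    rw [Matrix.trace_mul_comm, ← Matrix.mul_assoc, hU, Matrix.one_mul, h.trace]

end IsRankProj

variable [DecidableEq ι]

theorem isRankProj_diagonal (T : Finset ι) :
    IsRankProj T.card (diagonal fun i => if i ∈ T then (1 : ℝ) else 0) where
  transpose := diagonal_transpose _
  idem := by simp [diagonal_mul_diagonal]
  trace := by simp [trace_diagonal]

theorem Matrix.trace_conj_diagonal_mul (U S : Matrix ι ι ℝ) (d : ι → ℝ) :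
    (U * diagonal d * Uᵀ * S).trace = ∑ i, d i * (Uᵀ * S * U) i i := by
  have : (U * diagonal d * Uᵀ * S).trace = (diagonal d * (Uᵀ * S * U)).trace := by
    rw [Matrix.mul_assoc, Matrix.mul_assoc, Matrix.trace_mul_comm]
    simp only [Matrix.mul_assoc]
  rw [this]
  simp [Matrix.trace, diagonal_mul]

/-- The sum of the `k` largest eigenvalues of a symmetric matrix. -/
noncomputable def topEigSum (H : Matrix ι ι ℝ) (k : ℕ) : ℝ :=
  ∑ i ∈ Finset.range k, nthLargest H.charpoly.roots i

theorem Matrix.IsHermitian.nthLargest_eq {H : Matrix ι ι ℝ} (hH : H.IsHermitian)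
    (i : Fin (Fintype.card ι)) : nthLargest H.charpoly.roots i = hH.eigenvalues₀ i := by
  have h := hH.sort_roots_charpoly_eq_eigenvalues₀
  simp only [RCLike.re_to_real, Multiset.map_id'] at h
  rw [nthLargest, h]
  simp

theorem exists_spectral_splitting {H : Matrix ι ι ℝ} (hH : Hᵀ = H) {k : ℕ} (hk : 1 ≤ k)
    (hkc : k ≤ Fintype.card ι) :
    ∃ (U : Matrix ι ι ℝ) (d : ι → ℝ) (T : Finset ι), Uᵀ * U = 1 ∧ U * Uᵀ = 1 ∧
      H = U * diagonal d * Uᵀ ∧ T.card = k ∧ topEigSum H k = ∑ i ∈ T, d i ∧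
      (∀ i ∈ T, nthLargest H.charpoly.roots (k - 1) ≤ d i) ∧
      ∀ i ∉ T, d i ≤ nthLargest H.charpoly.roots k ∧
        d i ≤ nthLargest H.charpoly.roots (k - 1) := by
  have hh : H.IsHermitian := by simpa [Matrix.IsHermitian] using hH
  let e : Fin (Fintype.card ι) ≃ ι := Fintype.equivOfCardEq (Fintype.card_fin _)
  let T₀ : Finset (Fin (Fintype.card ι)) := Finset.univ.filter fun i => (i : ℕ) < k
  have hd : ∀ i, hh.eigenvalues (e i) = hh.eigenvalues₀ i := fun i => by
    simp [Matrix.IsHermitian.eigenvalues, e]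
  have hT : ∀ i, i ∈ T₀.map e.toEmbedding ↔ ((e.symm i : Fin _) : ℕ) < k := fun i => by
    simp [T₀, Finset.mem_map_equiv]
  have hT₀ : T₀ = Finset.univ.map (Fin.castLEEmb hkc) := by
    ext i
    simp only [T₀, Finset.mem_filter, Finset.mem_univ, true_and, Finset.mem_map]
    exact ⟨fun h => ⟨⟨i, h⟩, rfl⟩, by rintro ⟨j, rfl⟩; exact j.2⟩
  have hU := hh.eigenvectorUnitary.2
  rw [Matrix.mem_unitaryGroup_iff] at hU
  have hU' := hh.eigenvectorUnitary.2
  rw [Matrix.mem_unitaryGroup_iff'] at hU'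
  rw [Matrix.star_eq_conjTranspose, Matrix.conjTranspose_eq_transpose_of_trivial] at hU hU'
  refine ⟨hh.eigenvectorUnitary, hh.eigenvalues, T₀.map e.toEmbedding, hU', hU, ?_, ?_, ?_, ?_, ?_⟩
  · conv_lhs => rw [hh.spectral_theorem]
    rw [Unitary.conjStarAlgAut_apply, Matrix.star_eq_conjTranspose,
      Matrix.conjTranspose_eq_transpose_of_trivial]
    rfl
  · rw [Finset.card_map, hT₀]
    simp
  · rw [Finset.sum_map, hT₀, Finset.sum_map, topEigSum, Finset.sum_range]
    refine Finset.sum_congr rfl fun i _ => ?_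
    rw [Equiv.coe_toEmbedding, hd]
    exact hh.nthLargest_eq (Fin.castLE hkc i)
  · intro i hi
    rw [hT] at hi
    rw [show k - 1 = ((⟨k - 1, by omega⟩ : Fin (Fintype.card ι)) : ℕ) from rfl, hh.nthLargest_eq]
    refine hh.eigenvalues₀_antitone (Fin.le_def.2 ?_)
    change ((e.symm i : Fin _) : ℕ) ≤ k - 1
    omega
  · intro i hi
    rw [hT, not_lt] at hi
    have hlt : k < Fintype.card ι := hi.trans_lt (e.symm i).2
    constructor
    · rw [show k = ((⟨k, hlt⟩ : Fin (Fintype.card ι)) : ℕ) from rfl, hh.nthLargest_eq]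
      exact hh.eigenvalues₀_antitone (Fin.le_def.2 hi)
    · rw [show k - 1 = ((⟨k - 1, by omega⟩ : Fin (Fintype.card ι)) : ℕ) from rfl,
        hh.nthLargest_eq]
      refine hh.eigenvalues₀_antitone (Fin.le_def.2 ?_)
      change k - 1 ≤ ((e.symm i : Fin _) : ℕ)
      omega

/-- **Ky Fan's maximum principle**, with a quadratic estimate in the presence of a spectral gap. -/
theorem exists_kyFan_maximizer {H : Matrix ι ι ℝ} (hH : Hᵀ = H) {k : ℕ} (hk : 1 ≤ k)
    (hkc : k ≤ Fintype.card ι) :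
    ∃ S₀ : Matrix ι ι ℝ, IsRankProj k S₀ ∧ (H * S₀).trace = topEigSum H k ∧
      ∀ δ : ℝ, 0 ≤ δ → (δ = 0 ∨ δ ≤ nthLargest H.charpoly.roots (k - 1) -
        nthLargest H.charpoly.roots k) → ∀ S : Matrix ι ι ℝ, IsRankProj k S →
        (H * S).trace + δ / 2 * ∑ i, ∑ j, (S - S₀) i j ^ 2 ≤ topEigSum H k := by
  obtain ⟨U, d, T, hU', hU, hHU, hT, hsum, hin, hout⟩ := exists_spectral_splitting hH hk hkc
  set E : Matrix ι ι ℝ := diagonal fun i => if i ∈ T then (1 : ℝ) else 0 with hE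
  have hS₀ : IsRankProj k (U * E * Uᵀ) := by
    have := (isRankProj_diagonal T).conj (U := Uᵀ) (by rwa [transpose_transpose])
    rwa [transpose_transpose, hT] at this
  have hconj : Uᵀ * (U * E * Uᵀ) * U = E := by
    calc Uᵀ * (U * E * Uᵀ) * U = (Uᵀ * U) * E * (Uᵀ * U) := by simp only [Matrix.mul_assoc]
      _ = E := by rw [hU', Matrix.one_mul, Matrix.mul_one]
  refine ⟨U * E * Uᵀ, hS₀, ?_, fun δ hδ hgap S hS => ?_⟩
  · conv_lhs => rw [hHU]
    rw [Matrix.trace_conj_diagonal_mul, hconj, hsum]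
    simp [hE]
  -- In the eigenbasis the diagonal of a rank-`k` projection is a weight with values in `[0, 1]` and
  -- total mass `k`.
  · set p : ι → ℝ := fun i => (Uᵀ * S * U) i i with hp
    have hP := hS.conj hU
    have hp0 : ∀ i, 0 ≤ p i := hP.diag_nonneg
    have hp1 : ∀ i, p i ≤ 1 := hP.diag_le_one
    have hpk : ∑ i, p i = k := hP.trace
    have htr : (H * S).trace = ∑ i, d i * p i := by
      conv_lhs => rw [hHU]
      rw [Matrix.trace_conj_diagonal_mul]
    have htr₀ : (U * E * Uᵀ * S).trace = ∑ i ∈ T, p i := by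
      rw [hE, Matrix.trace_conj_diagonal_mul]
      simp [hp]
    have hfrob : ∑ i, ∑ j, (S - U * E * Uᵀ) i j ^ 2 = 2 * (k - ∑ i ∈ T, p i) := by
      rw [Matrix.sum_sq_eq_trace, transpose_sub, hS.transpose, hS₀.transpose, Matrix.sub_mul,
        Matrix.mul_sub, Matrix.mul_sub, hS.idem, hS₀.idem, trace_sub, trace_sub, trace_sub,
        hS.trace, hS₀.trace, Matrix.trace_mul_comm S, htr₀]
      ring
    rw [htr, hfrob, hsum]
    set c := nthLargest H.charpoly.roots (k - 1)
    -- The case `δ = 0` needs only the ordering. It is separate because for `k` the full dimension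
    -- the `k`-th entry is the default `0`, which may exceed every eigenvalue.
    have hout' : ∀ i ∉ T, d i ≤ c - δ := by
      intro i hi
      rcases hgap with h | h
      · linarith [(hout i hi).2]
      · linarith [(hout i hi).1]
    have hcompl : ∑ i ∈ Tᶜ, p i = k - ∑ i ∈ T, p i := by
      rw [← hpk, ← Finset.sum_add_sum_compl T p]
      ring
    -- The mass missing from `T` lies outside `T`, and each unit of it costs at least `δ`.
    have h1 : ∑ i ∈ T, c * (1 - p i) ≤ ∑ i ∈ T, d i * (1 - p i) :=
      Finset.sum_le_sum fun i hi =>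
        mul_le_mul_of_nonneg_right (hin i hi) (by linarith [hp1 i])
    have h2 : ∑ i ∈ Tᶜ, d i * p i ≤ ∑ i ∈ Tᶜ, (c - δ) * p i :=
      Finset.sum_le_sum fun i hi =>
        mul_le_mul_of_nonneg_right (hout' i (Finset.mem_compl.1 hi)) (hp0 i)
    rw [← Finset.mul_sum, hcompl] at h2
    rw [← Finset.mul_sum] at h1
    simp only [mul_sub, mul_one, Finset.sum_sub_distrib, Finset.sum_const, hT, nsmul_eq_mul] at h1
    rw [← Finset.sum_add_sum_compl T fun i => d i * p i]
    linarith

end KyFan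

/-! ### Differentiability of eigenvalue sums along a curve -/

theorem HasDerivAt.zero_of_abs_le {e b : ℝ → ℝ} {t₀ : ℝ} (h : ∀ t, |e t| ≤ |b t|)
    (hb : HasDerivAt b 0 t₀) (hb₀ : b t₀ = 0) : HasDerivAt e 0 t₀ := by
  have he₀ : e t₀ = 0 := by simpa [hb₀] using h t₀
  rw [hasDerivAt_iff_isLittleO] at hb ⊢
  simp only [hb₀, he₀, sub_zero, smul_zero] at hb ⊢
  exact (Asymptotics.IsBigO.of_bound 1 (Eventually.of_forall fun t => by
    simpa using h t)).trans_isLittleO hb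

section TopEigSum

open Matrix

variable {ι : Type*} [Fintype ι] [DecidableEq ι] {k : ℕ}

theorem IsRankProj.trace_mul_le_topEigSum {S H : Matrix ι ι ℝ} (hS : IsRankProj k S)
    (hH : Hᵀ = H) (hk : 1 ≤ k) (hkc : k ≤ Fintype.card ι) : (H * S).trace ≤ topEigSum H k := by
  obtain ⟨S₀, -, -, h⟩ := exists_kyFan_maximizer hH hk hkc
  simpa using h 0 le_rfl (Or.inl rfl) S hS

theorem exists_isRankProj_trace_eq {H : Matrix ι ι ℝ} (hH : Hᵀ = H) (hk : 1 ≤ k)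
    (hkc : k ≤ Fintype.card ι) :
    ∃ S : Matrix ι ι ℝ, IsRankProj k S ∧ (H * S).trace = topEigSum H k :=
  let ⟨S, hS, h, _⟩ := exists_kyFan_maximizer hH hk hkc
  ⟨S, hS, h⟩

/-- The maximizing projection for `H` is a competitor for `K`, and its entries are bounded. -/
theorem topEigSum_sub_le {H K : Matrix ι ι ℝ} (hH : Hᵀ = H) (hK : Kᵀ = K) (hk : 1 ≤ k)
    (hkc : k ≤ Fintype.card ι) :
    topEigSum H k - topEigSum K k ≤ (k + 1) * ∑ i, ∑ j, |H i j - K i j| := by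
  obtain ⟨S, hS, h⟩ := exists_isRankProj_trace_eq hH hk hkc
  have h1 := hS.trace_mul_le_topEigSum hK hk hkc
  have h2 : ((H - K) * S).trace ≤ (k + 1) * ∑ i, ∑ j, |H i j - K i j| := by
    simp only [Matrix.trace, Matrix.diag_apply, Matrix.mul_apply, Finset.mul_sum]
    refine Finset.sum_le_sum fun i _ => Finset.sum_le_sum fun j _ => ?_
    refine (le_abs_self _).trans ?_
    rw [abs_mul, mul_comm]
    exact mul_le_mul_of_nonneg_right (hS.abs_apply_le j i) (abs_nonneg _)
  rw [Matrix.sub_mul, trace_sub] at h2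
  linarith

theorem abs_topEigSum_sub_le {H K : Matrix ι ι ℝ} (hH : Hᵀ = H) (hK : Kᵀ = K) (hk : 1 ≤ k)
    (hkc : k ≤ Fintype.card ι) :
    |topEigSum H k - topEigSum K k| ≤ (k + 1) * ∑ i, ∑ j, |H i j - K i j| := by
  rw [abs_le']
  refine ⟨topEigSum_sub_le hH hK hk hkc, ?_⟩
  rw [neg_sub]
  simpa only [abs_sub_comm] using topEigSum_sub_le hK hH hk hkc

theorem convexOn_topEigSum_line {H D : Matrix ι ι ℝ} (hH : Hᵀ = H) (hD : Dᵀ = D) (hk : 1 ≤ k)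
    (hkc : k ≤ Fintype.card ι) : ConvexOn ℝ univ fun t : ℝ => topEigSum (H + t • D) k := by
  have hsymm : ∀ t : ℝ, (H + t • D)ᵀ = H + t • D := fun t => by simp [hH, hD]
  refine ⟨convex_univ, fun x _ y _ a b ha hb hab => ?_⟩
  obtain ⟨S, hS, h⟩ := exists_isRankProj_trace_eq (hsymm (a • x + b • y)) hk hkc
  have hx := hS.trace_mul_le_topEigSum (hsymm x) hk hkc
  have hy := hS.trace_mul_le_topEigSum (hsymm y) hk hkc
  simp only [Matrix.add_mul, Matrix.smul_mul, trace_add, trace_smul, smul_eq_mul] at h hx hy ⊢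
  rw [← h]
  calc (H * S).trace + (a * x + b * y) * (D * S).trace
      = a * ((H * S).trace + x * (D * S).trace) + b * ((H * S).trace + y * (D * S).trace) := by
        linear_combination (-(H * S).trace) * hab
    _ ≤ _ := add_le_add (mul_le_mul_of_nonneg_left hx ha) (mul_le_mul_of_nonneg_left hy hb)

variable {H : ℝ → Matrix ι ι ℝ} {D : Matrix ι ι ℝ} {t₀ : ℝ}

/-- The sum of the `k` largest eigenvalues along a differentiable curve of symmetric matrices has
one-sided derivatives, the left one being at most the right one. -/
theorem exists_oneSided_deriv_topEigSum (hH : ∀ t, (H t)ᵀ = H t)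
    (hD : ∀ i j, HasDerivAt (fun t => H t i j) (D i j) t₀) (hk : 1 ≤ k)
    (hkc : k ≤ Fintype.card ι) :
    ∃ dl dr : ℝ, HasDerivWithinAt (fun t => topEigSum (H t) k) dl (Iio t₀) t₀ ∧
      HasDerivWithinAt (fun t => topEigSum (H t) k) dr (Ioi t₀) t₀ ∧ dl ≤ dr := by
  have hDs : Dᵀ = D := by
    ext i j
    refine (hD j i).unique ((hD i j).congr_of_eventuallyEq (Eventually.of_forall fun t => ?_))
    exact congrFun (congrFun (hH t) i) j
  -- `H₁ + t • D` is the tangent line at `t₀`. The sum is convex along it, and by the Lipschitz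
  -- bound replacing the curve by the tangent changes no one-sided derivative.
  set H₁ : Matrix ι ι ℝ := H t₀ - t₀ • D with hH₁
  have hH₁s : H₁ᵀ = H₁ := by simp [hH₁, hH, hDs]
  have hconv := convexOn_topEigSum_line hH₁s hDs hk hkc
  have hmem : t₀ ∈ interior (univ : Set ℝ) := by simp
  have he : HasDerivAt (fun t => topEigSum (H t) k - topEigSum (H₁ + t • D) k) 0 t₀ := by
    have hent : ∀ i j, HasDerivAt (fun t => H t i j - (H₁ + t • D) i j) 0 t₀ := fun i j => by
      have h1 : HasDerivAt (fun t => (H₁ + t • D) i j) (D i j) t₀ := by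
        simpa [mul_comm] using! ((hasDerivAt_id t₀).mul_const (D i j)).const_add (H₁ i j)
      simpa using (hD i j).fun_sub h1
    have hzero : ∀ i j, H t₀ i j - (H₁ + t₀ • D) i j = 0 := fun i j => by simp [hH₁]
    refine HasDerivAt.zero_of_abs_le
      (b := fun t => (k + 1) * ∑ i, ∑ j, |H t i j - (H₁ + t • D) i j|) (fun t => ?_) ?_ ?_
    · exact (abs_topEigSum_sub_le (hH t) (by simp [hH₁s, hDs]) hk hkc).trans (le_abs_self _)
    · have habs : ∀ i j, HasDerivAt (fun t => |H t i j - (H₁ + t • D) i j|) 0 t₀ := fun i j =>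
        HasDerivAt.zero_of_abs_le (fun t => (abs_abs _).le) (hent i j) (hzero i j)
      simpa using (HasDerivAt.fun_sum fun i (_ : i ∈ Finset.univ) =>
        HasDerivAt.fun_sum fun j (_ : j ∈ Finset.univ) => habs i j).const_mul ((k : ℝ) + 1)
    · simp only [hzero, abs_zero, Finset.sum_const_zero, mul_zero]
  refine ⟨_, _, ?_, ?_, hconv.leftDeriv_le_rightDeriv_of_mem_interior hmem⟩
  · simpa using he.hasDerivWithinAt.fun_add (hconv.hasDerivWithinAt_leftDeriv_of_mem_interior hmem)
  · simpa using he.hasDerivWithinAt.fun_add (hconv.hasDerivWithinAt_rightDeriv_of_mem_interior hmem)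

/-- If the `k`-th and `k + 1`-st eigenvalues differ, then the sum of the `k` largest eigenvalues
along a differentiable curve of symmetric matrices is differentiable. -/
theorem differentiableAt_topEigSum (hH : ∀ t, (H t)ᵀ = H t)
    (hD : ∀ i j, HasDerivAt (fun t => H t i j) (D i j) t₀) (hk : 1 ≤ k)
    (hkc : k ≤ Fintype.card ι) (hgap : nthLargest (H t₀).charpoly.roots k <
      nthLargest (H t₀).charpoly.roots (k - 1)) :
    DifferentiableAt ℝ (fun t => topEigSum (H t) k) t₀ := by
  obtain ⟨S₀, hS₀, htr, hmax⟩ := exists_kyFan_maximizer (hH t₀) hk hkc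
  set δ := nthLargest (H t₀).charpoly.roots (k - 1) - nthLargest (H t₀).charpoly.roots k with hδ
  have hδ0 : 0 < δ := sub_pos.2 hgap
  have hlin : DifferentiableAt ℝ (fun t => (H t * S₀).trace) t₀ := by
    simp only [Matrix.trace, Matrix.diag_apply, Matrix.mul_apply]
    exact DifferentiableAt.fun_sum fun i _ => DifferentiableAt.fun_sum fun j _ =>
      (hD i j).differentiableAt.mul_const _
  -- The fixed projection `S₀` gives a differentiable minorant. The quadratic term in Ky Fan's
  -- principle absorbs `S - S₀` through Young's inequality, leaving an error of second order in `H t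
  -- - H t₀`.
  have hquad : ∀ t, |topEigSum (H t) k - (H t * S₀).trace| ≤
      |1 / (2 * δ) * ∑ i, ∑ j, (H t i j - H t₀ i j) ^ 2| := by
    intro t
    rw [abs_of_nonneg (sub_nonneg.2 (hS₀.trace_mul_le_topEigSum (hH t) hk hkc)),
      abs_of_nonneg (by positivity)]
    obtain ⟨S, hS, hSt⟩ := exists_isRankProj_trace_eq (hH t) hk hkc
    have h1 := hmax δ hδ0.le (Or.inr le_rfl) S hS
    have h2 : ((H t - H t₀) * (S - S₀)ᵀ).trace ≤
        1 / (2 * δ) * ∑ i, ∑ j, (H t i j - H t₀ i j) ^ 2 +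
          δ / 2 * ∑ i, ∑ j, (S - S₀) i j ^ 2 := by
      simp only [Matrix.trace, Matrix.diag_apply, Matrix.mul_apply, Finset.mul_sum,
        transpose_apply, ← Finset.sum_add_distrib]
      refine Finset.sum_le_sum fun i _ => Finset.sum_le_sum fun j _ => ?_
      rw [Matrix.sub_apply (H t)]
      set x := H t i j - H t₀ i j
      set y := (S - S₀) i j
      have : 1 / (2 * δ) * x ^ 2 + δ / 2 * y ^ 2 - x * y = 1 / (2 * δ) * (x - δ * y) ^ 2 := by
        field_simp
        ring
      have h3 : 0 ≤ 1 / (2 * δ) * (x - δ * y) ^ 2 := by positivity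
      linarith
    rw [transpose_sub, hS.transpose, hS₀.transpose, Matrix.sub_mul, Matrix.mul_sub,
      Matrix.mul_sub, trace_sub, trace_sub, trace_sub] at h2
    linarith
  have he : HasDerivAt (fun t => topEigSum (H t) k - (H t * S₀).trace) 0 t₀ := by
    refine HasDerivAt.zero_of_abs_le hquad ?_ (by simp)
    have hsq : ∀ i j, HasDerivAt (fun t => (H t i j - H t₀ i j) ^ 2) 0 t₀ := fun i j => by
      simpa using ((hD i j).sub_const (H t₀ i j)).fun_pow 2
    simpa using (HasDerivAt.fun_sum fun i (_ : i ∈ Finset.univ) =>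
      HasDerivAt.fun_sum fun j (_ : j ∈ Finset.univ) => hsq i j).const_mul (1 / (2 * δ))
  simpa using he.differentiableAt.fun_add hlin

end TopEigSum

/-! ### Uniqueness of the Gramians -/

section Lyapunov

open Matrix Polynomial

variable {n : ℕ}

/-- Intertwining extends to polynomials: `p(A) Y = Y p(B)`. For `p` the characteristic polynomial of
`B` the right side vanishes by Cayley–Hamilton, while `p(A)` is invertible by spectral mapping. -/
theorem Matrix.mul_eq_zero_of_sylvester {ι κ : Type*} [Fintype ι] [DecidableEq ι] [Fintype κ]
    [DecidableEq κ] {A : Matrix ι ι ℂ} {B : Matrix κ κ ℂ} {Y : Matrix ι κ ℂ}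
    (hAB : ∀ z ∈ spectrum ℂ A, z ∉ spectrum ℂ B) (h : A * Y = Y * B) : Y = 0 := by
  have hpow : ∀ p : ℂ[X], aeval A p * Y = Y * aeval B p := by
    intro p
    induction p using Polynomial.induction_on' with
    | add p q hp hq => rw [map_add, map_add, Matrix.add_mul, Matrix.mul_add, hp, hq]
    | monomial k a =>
      have hk : A ^ k * Y = Y * B ^ k := by
        induction k with
        | zero => simp
        | succ k ih => rw [pow_succ', pow_succ, Matrix.mul_assoc, ih, ← Matrix.mul_assoc, h,
            Matrix.mul_assoc, ← pow_succ', pow_succ]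
      simp [aeval_monomial, Algebra.algebraMap_eq_smul_one, hk]
  have hzero := hpow B.charpoly
  rw [aeval_self_charpoly, Matrix.mul_zero] at hzero
  have hunit : IsUnit (aeval A B.charpoly) := by
    rcases isEmpty_or_nonempty ι with hι | hι
    · exact ⟨1, Subsingleton.elim _ _⟩
    · by_contra hnu
      rw [← spectrum.zero_mem_iff ℂ, spectrum.map_polynomial_aeval_of_nonempty A _
        (spectrum.nonempty_of_isAlgClosed_of_finiteDimensional ℂ A)] at hnu
      obtain ⟨z, hz, hz0⟩ := hnu
      exact hAB z hz (Matrix.mem_spectrum_iff_isRoot_charpoly.2 hz0)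
  obtain ⟨u, hu⟩ := hunit
  calc Y = ((u⁻¹ : (Matrix ι ι ℂ)ˣ) : Matrix ι ι ℂ) * (u : Matrix ι ι ℂ) * Y := by simp
    _ = 0 := by rw [hu, Matrix.mul_assoc, hzero, Matrix.mul_zero]

theorem AsymptoticallyStable.transpose {A : Matrix (Fin n) (Fin n) ℝ}
    (hA : AsymptoticallyStable A) : AsymptoticallyStable Aᵀ := by
  intro z hz
  refine hA z ?_
  rw [Matrix.mem_spectrum_iff_isRoot_charpoly] at hz ⊢
  rwa [Matrix.transpose_map, Matrix.charpoly_transpose] at hz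

/-- The spectra of `A` and `-Aᵀ` lie in opposite open half-planes. -/
theorem AsymptoticallyStable.eq_zero_of_lyapunov {A Y : Matrix (Fin n) (Fin n) ℝ}
    (hA : AsymptoticallyStable A) (h : A * Y + Y * Aᵀ = 0) : Y = 0 := by
  have hY : Y.map (algebraMap ℝ ℂ) = 0 := by
    refine Matrix.mul_eq_zero_of_sylvester (A := A.map (algebraMap ℝ ℂ))
      (B := -(Aᵀ.map (algebraMap ℝ ℂ))) (fun z hz hz' => ?_) ?_
    · have h1 := hA z hz
      rw [← spectrum.neg_eq, Set.mem_neg] at hz'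
      have h2 := hA.transpose (-z) hz'
      simp only [Complex.neg_re] at h2
      linarith
    · rw [Matrix.mul_neg, ← Matrix.map_mul, ← Matrix.map_mul, eq_neg_of_add_eq_zero_left h]
      ext i j
      simp
  ext i j
  simpa using congrFun (congrFun hY i) j

theorem AsymptoticallyStable.controllabilityGramian_eq {ι : Type} [Fintype ι]
    {A P : Matrix (Fin n) (Fin n) ℝ} {B : Matrix (Fin n) ι ℝ} (hA : AsymptoticallyStable A)
    (hP : IsControllabilityGramian A B P) : controllabilityGramian A B = P := by
  have h : IsControllabilityGramian A B (controllabilityGramian A B) :=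
    Classical.epsilon_spec ⟨P, hP⟩
  rw [IsControllabilityGramian] at h hP
  refine sub_eq_zero.1 (hA.eq_zero_of_lyapunov ?_)
  rw [← sub_self (0 : Matrix (Fin n) (Fin n) ℝ)]
  nth_rw 1 [← h]
  rw [← hP]
  noncomm_ring

theorem AsymptoticallyStable.observabilityGramian_eq {κ : Type} [Fintype κ]
    {A Q : Matrix (Fin n) (Fin n) ℝ} {C : Matrix κ (Fin n) ℝ} (hA : AsymptoticallyStable A)
    (hQ : IsObservabilityGramian A C Q) : observabilityGramian A C = Q := by
  have h : IsObservabilityGramian A C (observabilityGramian A C) :=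
    Classical.epsilon_spec ⟨Q, hQ⟩
  rw [IsObservabilityGramian] at h hQ
  refine sub_eq_zero.1 (hA.transpose.eq_zero_of_lyapunov ?_)
  rw [transpose_transpose, ← sub_self (0 : Matrix (Fin n) (Fin n) ℝ)]
  nth_rw 1 [← h]
  rw [← hQ]
  noncomm_ring

/-! ### Hankel singular values through the factor matrix -/

variable {m p q k kh l : ℕ}
  {A : Matrix (Fin n) (Fin n) ℝ} {B : Matrix (Fin n) (Fin m) ℝ}
  {C : Matrix (Fin p) (Fin n) ℝ} {X₀ : Matrix (Fin n) (Fin q) ℝ}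
  {R : Matrix (Fin n) (Fin k) ℝ} {Rh : Matrix (Fin n) (Fin kh) ℝ} {L : Matrix (Fin n) (Fin l) ℝ}

theorem Matrix.expandedInput_mul_transpose (A : Matrix (Fin n) (Fin n) ℝ)
    (B : Matrix (Fin n) (Fin m) ℝ) (X₀ : Matrix (Fin n) (Fin q) ℝ) (β α : ℝ) :
    expandedInput A B X₀ β α * (expandedInput A B X₀ β α)ᵀ =
      B * Bᵀ + (1 / (β * Real.sqrt (2 * α))) ^ 2 • ((A + α • 1) * (X₀ * X₀ᵀ) * (A + α • 1)ᵀ) := by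
  rw [expandedInput, transpose_fromCols, fromCols_mul_fromRows, transpose_smul, transpose_mul,
    Matrix.smul_mul, Matrix.mul_smul, smul_smul, pow_two]
  simp only [Matrix.mul_assoc]

/-- Since `A` commutes with `A + α I`, congruence by `A + α I` turns the Lyapunov equation for `X₀`
into the one for `(A + α I) X₀`; the two equations then add. -/
theorem isControllabilityGramian_expandedInput
    (hR : IsControllabilityGramian A B (R * Rᵀ)) (hRh : IsControllabilityGramian A X₀ (Rh * Rhᵀ))
    (β α : ℝ) :
    IsControllabilityGramian A (expandedInput A B X₀ β α)
      (expandedInput A R Rh β α * (expandedInput A R Rh β α)ᵀ) := by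
  rw [IsControllabilityGramian] at *
  rw [Matrix.expandedInput_mul_transpose, Matrix.expandedInput_mul_transpose]
  set c := (1 / (β * Real.sqrt (2 * α))) ^ 2
  set P := Rh * Rhᵀ
  set K := A + α • (1 : Matrix (Fin n) (Fin n) ℝ) with hK
  have hc1 : A * K = K * A := by
    rw [hK, Matrix.mul_add, Matrix.add_mul]
    simp
  have hc2 : Kᵀ * Aᵀ = Aᵀ * Kᵀ := by rw [← transpose_mul, ← transpose_mul, hc1]
  have e1 : A * (K * P * Kᵀ) = K * (A * P) * Kᵀ := by
    rw [← Matrix.mul_assoc, ← Matrix.mul_assoc, hc1]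
    simp only [Matrix.mul_assoc]
  have e2 : K * P * Kᵀ * Aᵀ = K * (P * Aᵀ) * Kᵀ := by
    rw [Matrix.mul_assoc, hc2]
    simp only [Matrix.mul_assoc]
  clear_value K
  calc A * (R * Rᵀ + c • (K * P * Kᵀ)) + (R * Rᵀ + c • (K * P * Kᵀ)) * Aᵀ +
        (B * Bᵀ + c • (K * (X₀ * X₀ᵀ) * Kᵀ))
      = (A * (R * Rᵀ) + R * Rᵀ * Aᵀ + B * Bᵀ) +
          c • (K * (A * P + P * Aᵀ + X₀ * X₀ᵀ) * Kᵀ) := by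
        rw [Matrix.mul_add, Matrix.add_mul, Matrix.mul_smul, Matrix.smul_mul, e1, e2]
        simp only [Matrix.mul_add, Matrix.add_mul, smul_add]
        abel
    _ = 0 := by rw [hR, hRh]; simp

theorem factorMatrix_eq {β α : ℝ} (hβ : 0 < β) (hα : 0 < α) :
    factorMatrix A R Rh L β α = Lᵀ * expandedInput A R Rh β α := by
  have h2 : Real.sqrt α / (Real.sqrt 2 * β) = 1 / (β * Real.sqrt (2 * α)) * α := by
    rw [Real.sqrt_mul zero_le_two]
    have h3 : Real.sqrt α ≠ 0 := (Real.sqrt_pos.2 hα).ne'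
    have h4 : Real.sqrt 2 ≠ 0 := by positivity
    field_simp
    rw [Real.sq_sqrt hα.le]
  rw [factorMatrix, expandedInput, mul_fromCols, h2, Matrix.mul_smul, Matrix.add_mul,
    Matrix.mul_add, smul_add, mul_smul]
  simp [Matrix.mul_assoc]

/-- The positive eigenvalues of the product of the Gramians are the squares of the positive
singular values of the factor matrix. -/
theorem filter_pos_roots_gramian_mul (hA : AsymptoticallyStable A)
    (hR : IsControllabilityGramian A B (R * Rᵀ)) (hRh : IsControllabilityGramian A X₀ (Rh * Rhᵀ))
    (hL : IsObservabilityGramian A C (L * Lᵀ)) {β α : ℝ} (hβ : 0 < β) (hα : 0 < α) :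
    (controllabilityGramian A (expandedInput A B X₀ β α) *
      observabilityGramian A C).charpoly.roots.filter (0 < ·) =
      (factorMatrix A R Rh L β α).posSqSingularValues := by
  -- With `E` the expanded input built from `R` and `Rh`, the product `(E Eᵀ L) Lᵀ` is swapped to
  -- `Lᵀ E Eᵀ L = M Mᵀ`.
  rw [hA.controllabilityGramian_eq (isControllabilityGramian_expandedInput hR hRh β α),
    hA.observabilityGramian_eq hL, ← Matrix.mul_assoc, Matrix.filter_pos_roots_charpoly_mul_comm,
    Matrix.posSqSingularValues, factorMatrix_eq hβ hα, transpose_mul, transpose_transpose]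
  simp only [Matrix.mul_assoc]

theorem card_filter_pos_dilation (M : Matrix (Fin l) (Fin k ⊕ Fin kh) ℝ) :
    (M.dilation.charpoly.roots.filter (0 < ·)).card = M.rank := by
  rw [Matrix.filter_pos_roots_charpoly_dilation, Multiset.card_map,
    Matrix.card_posSqSingularValues]

theorem shiftHSV_eq_nthLargest (hA : AsymptoticallyStable A)
    (hR : IsControllabilityGramian A B (R * Rᵀ)) (hRh : IsControllabilityGramian A X₀ (Rh * Rhᵀ))
    (hL : IsObservabilityGramian A C (L * Lᵀ)) {β α : ℝ} (hβ : 0 < β) (hα : 0 < α) {i : ℕ}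
    (hi : i < (factorMatrix A R Rh L β α).rank) :
    shiftHSV A B C X₀ β (i + 1) α =
      nthLargest (factorMatrix A R Rh L β α).dilation.charpoly.roots i := by
  have hf := filter_pos_roots_gramian_mul hA hR hRh hL hβ hα
  rw [← nthLargest.filter_pos (by rwa [card_filter_pos_dilation]),
    Matrix.filter_pos_roots_charpoly_dilation,
    nthLargest.map_sqrt (s := (factorMatrix A R Rh L β α).posSqSingularValues)
      (fun a ha => (Multiset.mem_filter.1 ha).2), ← hf,
    nthLargest.filter_pos (by rwa [hf, Matrix.card_posSqSingularValues])]
  rfl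

theorem shiftHSV_eq_zero (hA : AsymptoticallyStable A)
    (hR : IsControllabilityGramian A B (R * Rᵀ)) (hRh : IsControllabilityGramian A X₀ (Rh * Rhᵀ))
    (hL : IsObservabilityGramian A C (L * Lᵀ)) {β α : ℝ} (hβ : 0 < β) (hα : 0 < α) {i : ℕ}
    (hi : (factorMatrix A R Rh L β α).rank ≤ i) :
    shiftHSV A B C X₀ β (i + 1) α = 0 := by
  have hf := filter_pos_roots_gramian_mul hA hR hRh hL hβ hα
  refine Real.sqrt_eq_zero_of_nonpos (nthLargest.nonpos ?_)
  rwa [hf, Matrix.card_posSqSingularValues]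

theorem rank_factorMatrix_le (β α : ℝ) (hβ : 0 < β) (hα : 0 < α) :
    (factorMatrix A R Rh L β α).rank ≤ n := by
  rw [factorMatrix_eq hβ hα]
  exact (rank_mul_le_left _ _).trans (by simpa using rank_le_card_width Lᵀ)

theorem exists_hasDerivAt_dilation_factorMatrix (A : Matrix (Fin n) (Fin n) ℝ)
    (R : Matrix (Fin n) (Fin k) ℝ) (Rh : Matrix (Fin n) (Fin kh) ℝ) (L : Matrix (Fin n) (Fin l) ℝ)
    {β α₀ : ℝ} (hβ : 0 < β) (hα₀ : 0 < α₀) :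
    ∃ D : Matrix (Fin l ⊕ (Fin k ⊕ Fin kh)) (Fin l ⊕ (Fin k ⊕ Fin kh)) ℝ,
      ∀ i j, HasDerivAt (fun α => (factorMatrix A R Rh L β α).dilation i j) (D i j) α₀ := by
  have hM : ∀ i j, DifferentiableAt ℝ (fun α => factorMatrix A R Rh L β α i j) α₀ := by
    rintro i (j | j)
    · simp [factorMatrix]
    · simp only [factorMatrix, fromCols_apply_inr, Matrix.add_apply, Matrix.smul_apply,
        smul_eq_mul]
      have h1 : DifferentiableAt ℝ (fun α => Real.sqrt (2 * α)) α₀ :=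
        DifferentiableAt.sqrt (by fun_prop) (by positivity)
      have h2 : DifferentiableAt ℝ (fun α => Real.sqrt α) α₀ :=
        DifferentiableAt.sqrt (by fun_prop) hα₀.ne'
      have h3 : β * Real.sqrt (2 * α₀) ≠ 0 := by positivity
      exact (((differentiableAt_const _).fun_div (h1.const_mul β) h3).mul_const _).fun_add
        ((h2.div_const _).mul_const _)
  refine ⟨fun i j => deriv (fun α => (factorMatrix A R Rh L β α).dilation i j) α₀,
    fun i j => DifferentiableAt.hasDerivAt ?_⟩
  rcases i with i | i <;> rcases j with j | j
  · simp [Matrix.dilation]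
  · simpa [Matrix.dilation] using hM i j
  · simpa [Matrix.dilation] using hM j i
  · simp [Matrix.dilation]

end Lyapunov

/-! ### One-sided derivatives and the final argument -/

theorem HasDerivWithinAt.hasDerivAt_of_Iio_Ioi {f : ℝ → ℝ} {d x : ℝ}
    (hl : HasDerivWithinAt f d (Iio x) x) (hr : HasDerivWithinAt f d (Ioi x) x) :
    HasDerivAt f d x := by
  have := (hasDerivWithinAt_Iio_iff_Iic.1 hl).union (hasDerivWithinAt_Ioi_iff_Ici.1 hr)
  rwa [Iic_union_Ici, hasDerivWithinAt_univ] at this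

theorem IsLocalMin.leftDeriv_le_rightDeriv {f : ℝ → ℝ} {dl dr x : ℝ} (h : IsLocalMin f x)
    (hl : HasDerivWithinAt f dl (Iio x) x) (hr : HasDerivWithinAt f dr (Ioi x) x) : dl ≤ dr := by
  have hdl : dl ≤ 0 := by
    rw [hasDerivWithinAt_iff_tendsto_slope' self_notMem_Iio] at hl
    refine le_of_tendsto hl ?_
    filter_upwards [self_mem_nhdsWithin, nhdsWithin_le_nhds h] with y hy hfy
    rw [slope_def_field]
    exact div_nonpos_of_nonneg_of_nonpos (sub_nonneg.2 hfy) (sub_nonpos.2 (le_of_lt hy))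
  have hdr : 0 ≤ dr := by
    rw [hasDerivWithinAt_iff_tendsto_slope' self_notMem_Ioi] at hr
    refine ge_of_tendsto hr ?_
    filter_upwards [self_mem_nhdsWithin, nhdsWithin_le_nhds h] with y hy hfy
    rw [slope_def_field]
    exact div_nonneg (sub_nonneg.2 hfy) (sub_nonneg.2 (le_of_lt hy))
  exact hdl.trans hdr

theorem errorConstant_eq_of_nthLargest {n m p q : ℕ} {A : Matrix (Fin n) (Fin n) ℝ}
    {B : Matrix (Fin n) (Fin m) ℝ} {C : Matrix (Fin p) (Fin n) ℝ} {X₀ : Matrix (Fin n) (Fin q) ℝ}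
    {β α : ℝ} {r ρ : ℕ} {ι : Type*} [Fintype ι] [DecidableEq ι] {H : Matrix ι ι ℝ}
    (hr : r ≤ ρ) (hρ : ρ ≤ n)
    (hlt : ∀ i < ρ, shiftHSV A B C X₀ β (i + 1) α = nthLargest H.charpoly.roots i)
    (hge : ∀ i, ρ ≤ i → shiftHSV A B C X₀ β (i + 1) α = 0) :
    errorConstant A B C X₀ β r α = 2 * (topEigSum H ρ - topEigSum H r) := by
  have h1 : ∑ i ∈ Finset.Icc (r + 1) n, shiftHSV A B C X₀ β i α =
      ∑ i ∈ Finset.Ico r n, shiftHSV A B C X₀ β (i + 1) α := by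
    rw [Finset.sum_Ico_add' (fun i => shiftHSV A B C X₀ β i α)]
    rfl
  rw [errorConstant, h1, ← Finset.sum_Ico_consecutive _ hr hρ, topEigSum, topEigSum,
    ← Finset.sum_Ico_eq_sub _ hr,
    Finset.sum_congr rfl fun i hi => hlt i (Finset.mem_Ico.1 hi).2,
    Finset.sum_eq_zero fun i hi => hge i (Finset.mem_Ico.1 hi).1, add_zero]

theorem mainTheorem4 {n m p q k kh l : ℕ}
    (A : Matrix (Fin n) (Fin n) ℝ) (B : Matrix (Fin n) (Fin m) ℝ)
    (C : Matrix (Fin p) (Fin n) ℝ) (X₀ : Matrix (Fin n) (Fin q) ℝ)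
    (hA : AsymptoticallyStable A)
    (R : Matrix (Fin n) (Fin k) ℝ) (Rh : Matrix (Fin n) (Fin kh) ℝ)
    (L : Matrix (Fin n) (Fin l) ℝ)
    (hR : IsControllabilityGramian A B (R * R.transpose))
    (hRh : IsControllabilityGramian A X₀ (Rh * Rh.transpose))
    (hL : IsObservabilityGramian A C (L * L.transpose))
    (β : ℝ) (hβ : 0 < β) (r : ℕ) (hr : 1 ≤ r) (hrn : r + 1 ≤ n)
    (α₀ : ℝ) (hα₀ : 0 < α₀)
    (hdiff : ¬ DifferentiableAt ℝ (shiftHSV A B C X₀ β (r + 1)) α₀)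
    (habove : 2 ≤ r → shiftHSV A B C X₀ β r α₀ < shiftHSV A B C X₀ β (r - 1) α₀)
    (heq : shiftHSV A B C X₀ β r α₀ = shiftHSV A B C X₀ β (r + 1) α₀)
    (hbelow : r + 2 ≤ n →
      shiftHSV A B C X₀ β (r + 2) α₀ < shiftHSV A B C X₀ β (r + 1) α₀)
    (hrank : ∀ᶠ α in 𝓝 α₀,
      (factorMatrix A R Rh L β α).rank = (factorMatrix A R Rh L β α₀).rank) :
    (∃ dl dr : ℝ,
      HasDerivWithinAt (errorConstant A B C X₀ β r) dl (Iio α₀) α₀ ∧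
      HasDerivWithinAt (errorConstant A B C X₀ β r) dr (Ioi α₀) α₀ ∧ dr < dl) ∧
    ¬ IsLocalMin (errorConstant A B C X₀ β r) α₀ := by

  set M := factorMatrix A R Rh L β with hM
  set ρ := (M α₀).rank with hρ
  set H := fun α => (M α).dilation with hH
  have hsymm : ∀ α, (H α).transpose = H α := fun α => (M α).dilation_transpose
  obtain ⟨D, hD⟩ : ∃ D : Matrix (Fin l ⊕ (Fin k ⊕ Fin kh)) (Fin l ⊕ (Fin k ⊕ Fin kh)) ℝ,
      ∀ i j, HasDerivAt (fun α => H α i j) (D i j) α₀ :=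
    exists_hasDerivAt_dilation_factorMatrix A R Rh L hβ hα₀
  have hev : ∀ᶠ α in 𝓝 α₀, 0 < α ∧ (M α).rank = ρ := (lt_mem_nhds hα₀).and hrank
  have hlt : ∀ α, 0 < α ∧ (M α).rank = ρ → ∀ i < ρ,
      shiftHSV A B C X₀ β (i + 1) α = nthLargest (H α).charpoly.roots i := fun α hα i hi =>
    shiftHSV_eq_nthLargest hA hR hRh hL hβ hα.1 (hi.trans_eq hα.2.symm)
  have hge : ∀ α, 0 < α ∧ (M α).rank = ρ → ∀ i, ρ ≤ i →
      shiftHSV A B C X₀ β (i + 1) α = 0 := fun α hα i hi =>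
    shiftHSV_eq_zero hA hR hRh hL hβ hα.1 (hα.2.trans_le hi)
  have hρn : ρ ≤ n := rank_factorMatrix_le β α₀ hβ hα₀
  have hpos : ((H α₀).charpoly.roots.filter (0 < ·)).card = ρ := card_filter_pos_dilation _
  have hρc : ρ ≤ Fintype.card (Fin l ⊕ (Fin k ⊕ Fin kh)) := by
    rw [← hpos, ← (H α₀).charpoly_natDegree_eq_dim]
    exact (Multiset.card_le_card (Multiset.filter_le _ _)).trans (Polynomial.card_roots' _)
  -- Otherwise `η_{r+1}` would vanish identically near `α₀` and be differentiable there.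
  have hrρ : r < ρ := by
    by_contra! hle
    refine hdiff ((differentiableAt_const (0 : ℝ)).congr_of_eventuallyEq ?_)
    filter_upwards [hev] with α hα using hge α hα r hle
  have hgapρ : nthLargest (H α₀).charpoly.roots ρ < nthLargest (H α₀).charpoly.roots (ρ - 1) :=
    (nthLargest.nonpos hpos.le).trans_lt (nthLargest.pos (by omega))
  have hgapr : nthLargest (H α₀).charpoly.roots (r + 1) <
      nthLargest (H α₀).charpoly.roots (r + 1 - 1) := by
    -- If `r + 1 = ρ`, the gap is the one at the rank; otherwise `r + 2 ≤ ρ ≤ n` and the assumed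
    -- strict inequality applies.
    rcases (Nat.succ_le_of_lt hrρ).eq_or_lt with h | h
    · rwa [← h] at hgapρ
    · have h' := hbelow (by omega)
      rwa [hlt α₀ hev.self_of_nhds (r + 1) h, hlt α₀ hev.self_of_nhds r hrρ] at h'
  have hdρ := (differentiableAt_topEigSum hsymm hD (by omega) hρc hgapρ).hasDerivAt
  have hdr := (differentiableAt_topEigSum hsymm hD (by omega) (by omega) hgapr).hasDerivAt
  obtain ⟨el, er, hel, her, hle⟩ :=
    exists_oneSided_deriv_topEigSum hsymm hD hr (hrρ.le.trans hρc)
  have hlt' : el < er := by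
    -- Equal one-sided derivatives would make `σ_r`, hence `σ_{r+1} - σ_r = η_{r+1}`,
    -- differentiable.
    refine lt_of_le_of_ne hle fun heq' => hdiff ?_
    subst heq'
    have hd := hdr.sub (hel.hasDerivAt_of_Iio_Ioi her)
    refine (hd.congr_of_eventuallyEq ?_).differentiableAt
    filter_upwards [hev] with α hα
    rw [hlt α hα r hrρ]
    simp [topEigSum, Finset.sum_range_succ]
  have hc : errorConstant A B C X₀ β r =ᶠ[𝓝 α₀]
      fun α => 2 * (topEigSum (H α) ρ - topEigSum (H α) r) := by
    filter_upwards [hev] with α hα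
    exact errorConstant_eq_of_nthLargest hrρ.le hρn (hlt α hα) (hge α hα)
  have hl := ((hdρ.hasDerivWithinAt.fun_sub hel).const_mul 2).congr_of_eventuallyEq
    (hc.filter_mono nhdsWithin_le_nhds) hc.self_of_nhds
  have hr' := ((hdρ.hasDerivWithinAt.fun_sub her).const_mul 2).congr_of_eventuallyEq
    (hc.filter_mono nhdsWithin_le_nhds) hc.self_of_nhds
  refine ⟨⟨_, _, hl, hr', by linarith⟩, fun hmin => ?_⟩
  linarith [hmin.leftDeriv_le_rightDeriv hl hr']
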